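/- **Setting.** Let $\|\cdot\|$ be a norm on $\mathbb{R}^p$. Let $\mathrm{pr}_1,\dots,\mathrm{pr}_L$ (the classes) and $\mathrm{pr}_0$ (the anomalies) be Borel probability measures on $\mathbb{R}^p$. Let $p_\ell>0$ with $\sum_\ell p_\ell=1$, and let $q_\ell\ge 0$, $\rho\ge 0$ with $\sum_\ell q_\ell+\rho=1$. The training pairs $(X_i,Y_i)$, $i\le n$, are i.i.d. with $\Pr(Y_i=\ell)=p_\ell$ and $X_i\mid Y_i=\ell\sim \mathrm{pr}_\ell$. The test pair $(X^{te},Y^{te})$ is independent of them: $Y^{te}=\ell\in\{1,\dots,L\}$ with probability $q_\ell$ and then $X^{te}\sim \mathrm{pr}_\ell$; $Y^{te}=0$ (an anomaly) with probability $\rho$ and then $X^{te}\sim \mathrm{pr}_0$. Everything is conditional on the training labels. So the class sizes $n_\ell=\#\{i: Y_i=\ell\}$ are fixed numbers, $1\le k\le n_\ell$ for every $\ell$, and $m_\ell=k/n_\ell$. For $x\in\mathbb{R}^p$ put $r_{\ell,t}(x)=\inf\{r:\mathrm{pr}_\ell(\|X-x\|^2\le r)>t\}$ and $$D_\ell(x)=\frac1{m_\ell}\int_0^{m_\ell}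 r_{\ell,t}(x)\,dt ,$$ the squared distance to the measure $\mathrm{pr}_\ell$ at resolution $m_\ell$. Let $\widehat D_\ell(x)$ be the average of $\|X_i-x\|^2$ over the $k$ nearest neighbours $X_i$ of $x$ among the training points with label $\ell$. The test statistic with thresholds $c_1,\dots,c_L$ is $T(x)=\prod_{\ell=1}^L \mathbf 1\{\widehat D_\ell(x)>c_\ell\}$. Fix $0<\alpha<1$ and, for each $\ell$, positive constants $C_\ell,C'_\ell,\varepsilon_\ell$, which do not depend on $n$, $k$ or the labels. Let $S_\ell$ and $S_0$ be the supports of $\mathrm{pr}_\ell$ and $\mathrm{pr}_0$. For $\delta\in(0,1)$ put $\beta_\ell=\beta_\ell(\delta)=\sqrt{(4/n_\ell)\{(p+1)\log(2n_\ell)+\log(8/\delta)\}}$. Consider the following conditions, for each $\ell$. * (2a) $c_\ell=\min\{s:\mathrm{pr}_\ell(D_\ell(X)\le s)\ge 1-\alpha\}$, and $c_\ell>0$. * (2b), for a given $\delta$: there are $M_\ell\ge 2c_\ell+C_\ell\beta_\ell(\beta_\ell+\sqrt{m_\ell})$ and $\tau_\ell<m_\ell/2$ such that $\mathrm{pr}_\ell(\|X-x\|^2\le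 M_\ell)\le\tau_\ell$ for $\mathrm{pr}_0$-almost every $x$. * (3a) For all $0<\varepsilon<\varepsilon_\ell$, $\eta\ge0$, $x\in S_\ell\cup S_0$ and $0<t<m_\ell$: if $\mathrm{pr}_\ell(\|X-x\|^2\le r_{\ell,t}(x)+\eta)-\mathrm{pr}_\ell(\|X-x\|^2\le r_{\ell,t}(x))\le\varepsilon$, then $\eta<C_\ell\varepsilon$. * (3b) For all $0<\varepsilon<\varepsilon_\ell$ and $\kappa<C'_\ell\varepsilon$: $\mathrm{pr}_\ell\{D_\ell(X)>c_\ell-\kappa\}-\mathrm{pr}_\ell\{D_\ell(X)>c_\ell\}\le\varepsilon$. **Theorem.** Let $0<c<1$. (a) *Type I error.* Suppose $\sum_\ell q_\ell>0$. Let $k=k_n$ and the training labels vary with $n$ so that $n_\ell\to\infty$ for every $\ell$. Suppose that for all large $n$ we have $1\le k\le n_\ell$ for every $\ell$, and (2a), (3a), (3b) hold with thresholds $c_\ell=c_{\ell,n}$. Then $$\limsup_{n\to\infty}\Pr\{T(X^{te})>c\mid Y^{te}\in\{1,\dots,L\}\}\le\alpha .$$ (b) *Power.* Suppose $\rho>0$.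 For every $n$, every $k\ge 1$, all training labels with $n_\ell\ge k$ for every $\ell$, and every $\delta\in(0,1)$: if (2a), (3a), (3b), and (2b) for this $\delta$ hold, then $$\Pr\{T(X^{te})>c\mid Y^{te}\notin\{1,\dots,L\}\}\ge 1-L\delta .$$ -/

import Mathlib

open MeasureTheory ProbabilityTheory Filter
open scoped NNReal

namespace Anomaly

noncomputable section

/-! ### Distance to measure and its empirical version -/

section Distance

variable {E : Type*} [NormedAddCommGroup E]

/-- `r_t(x)`: the smallest `r` (infimum) with `P(‖X - x‖² ≤ r) > t`. -/
def sqQuantile [MeasurableSpace E] (P : Measure E) (t : ℝ) (x : E) : ℝ :=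
  sInf {r : ℝ | t < P.real {z | ‖z - x‖ ^ 2 ≤ r}}

/-- The squared distance to the measure `P` at resolution `m`: `(1/m) ∫₀ᵐ r_t(x) dt`. -/
def dtmSq [MeasurableSpace E] (P : Measure E) (m : ℝ) (x : E) : ℝ :=
  (1 / m) * ∫ t in (0 : ℝ)..m, sqQuantile P t x

/-- Mean squared distance from `x` to the points `X i`, `i ∈ s`, normalised by `1 / k`. -/
def avgSqDist {n : ℕ} (k : ℕ) (X : Fin n → E) (x : E) (s : Finset (Fin n)) : ℝ :=
  (1 / (k : ℝ)) * ∑ i ∈ s, ‖X i - x‖ ^ 2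

/-- `s` is a set of `k` nearest neighbours of `x` among the points `X i`, `i ∈ I`. -/
def IsKNN {n : ℕ} (k : ℕ) (I : Finset (Fin n)) (X : Fin n → E) (x : E)
    (s : Finset (Fin n)) : Prop :=
  s ⊆ I ∧ s.card = k ∧ ∀ i ∈ s, ∀ j ∈ I, j ∉ s → ‖X i - x‖ ≤ ‖X j - x‖

/-- The average squared distance from `x` to its `k` nearest neighbours among the points `X i`,
`i ∈ I`, written as the least average over `k`-element subsets of `I`
(see `knnSqDist_eq` for the agreement with any choice of the `k` nearest neighbours). -/
def knnSqDist {n : ℕ} (k : ℕ) (I : Finset (Fin n)) (X : Fin n → E) (x : E) : ℝ :=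
  sInf (avgSqDist k X x '' {s : Finset (Fin n) | s ⊆ I ∧ s.card = k})

theorem knnSqDist_eq {n : ℕ} {k : ℕ} {I : Finset (Fin n)} {X : Fin n → E} {x : E}
    {s : Finset (Fin n)} (hs : IsKNN k I X x s) :
    knnSqDist k I X x = avgSqDist k X x s := by
  classical
  obtain ⟨hsI, hsk, hnn⟩ := hs
  refine IsLeast.csInf_eq ⟨⟨s, ⟨hsI, hsk⟩, rfl⟩, ?_⟩
  rintro _ ⟨u, ⟨huI, huk⟩, rfl⟩
  unfold avgSqDist
  refine mul_le_mul_of_nonneg_left ?_ (by positivity)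
  have hcard : (s \ u).card = (u \ s).card := by
    have h1 := Finset.card_sdiff_add_card_inter s u
    have h2 := Finset.card_sdiff_add_card_inter u s
    rw [Finset.inter_comm u s] at h2
    omega
  have e := Finset.equivOfCardEq hcard
  have key : ∑ i ∈ s \ u, ‖X i - x‖ ^ 2 ≤ ∑ i ∈ u \ s, ‖X i - x‖ ^ 2 := by
    rw [← Finset.sum_coe_sort (s \ u), ← Finset.sum_coe_sort (u \ s),
      ← Equiv.sum_comp e]
    refine Finset.sum_le_sum fun i _ => ?_
    have hi := (Finset.mem_sdiff.1 i.2).1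
    have hj := Finset.mem_sdiff.1 (e i).2
    exact pow_le_pow_left₀ (norm_nonneg _) (hnn _ hi _ (huI hj.1) hj.2) 2
  have h1 := Finset.sum_inter_add_sum_sdiff s u (fun i => ‖X i - x‖ ^ 2)
  have h2 := Finset.sum_inter_add_sum_sdiff u s (fun i => ‖X i - x‖ ^ 2)
  rw [Finset.inter_comm u s] at h2
  linarith

end Distance

/-! ### The mixture model -/

section Model

variable {E : Type*} [MeasurableSpace E] {L : ℕ}

/-- Law of a training pair `(X, Y)`: `Y = ℓ` with probability `w ℓ`, and then `X ∼ P ℓ`. -/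
def trainLaw (P : Fin L → Measure E) (w : Fin L → ℝ≥0) : Measure (E × Fin L) :=
  ∑ ℓ, w ℓ • (P ℓ).prod (Measure.dirac ℓ)

/-- Law of a test pair `(X, Y)`: `Y` is class `ℓ` (coded by `ℓ.succ`) with probability `q ℓ`, and
then `X ∼ P ℓ`; it is an anomaly (coded by `0`) with probability `ρ`, and then `X ∼ Pout`. -/
def testLaw (P : Fin L → Measure E) (Pout : Measure E) (q : Fin L → ℝ≥0) (ρ : ℝ≥0) :
    Measure (E × Fin (L + 1)) :=
  ∑ ℓ, q ℓ • (P ℓ).prod (Measure.dirac (Fin.succ ℓ)) + ρ • Pout.prod (Measure.dirac 0)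

/-- Law of `n` independent training pairs together with an independent test pair. -/
def jointLaw (P : Fin L → Measure E) (Pout : Measure E) (w q : Fin L → ℝ≥0) (ρ : ℝ≥0) (n : ℕ) :
    Measure ((Fin n → E × Fin L) × (E × Fin (L + 1))) :=
  (Measure.pi fun _ => trainLaw P w).prod (testLaw P Pout q ρ)

/-- Indices of the training points with label `ℓ`. -/
def classIdx {n : ℕ} (y : Fin n → Fin L) (ℓ : Fin L) : Finset (Fin n) :=
  Finset.univ.filter fun i => y i = ℓ

/-- The class size `n_ℓ`. -/
def classSize {n : ℕ} (y : Fin n → Fin L) (ℓ : Fin L) : ℕ := (classIdx y ℓ).card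

/-- The resolution `m_ℓ = k / n_ℓ`. -/
def resolution {n : ℕ} (k : ℕ) (y : Fin n → Fin L) (ℓ : Fin L) : ℝ :=
  (k : ℝ) / (classSize y ℓ : ℝ)

/-- The event that the training labels are `y`. -/
def trainLabels {n : ℕ} (y : Fin n → Fin L) :
    Set ((Fin n → E × Fin L) × (E × Fin (L + 1))) :=
  {ω | ∀ i, (ω.1 i).2 = y i}

/-- The event that the test point is not an anomaly. -/
def isNormal {n : ℕ} : Set ((Fin n → E × Fin L) × (E × Fin (L + 1))) := {ω | ω.2.2 ≠ 0}

/-- The event that the test point is an anomaly. -/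
def isAnomaly {n : ℕ} : Set ((Fin n → E × Fin L) × (E × Fin (L + 1))) := {ω | ω.2.2 = 0}

end Model

section Test

variable {E : Type*} [NormedAddCommGroup E] [MeasurableSpace E] {L : ℕ}

/-- The test statistic: the product over the classes of the indicators that the average squared
distance from the test point to its `k` nearest neighbours in class `ℓ` exceeds `c ℓ`. -/
def testStat {n : ℕ} (k : ℕ) (c : Fin L → ℝ)
    (ω : (Fin n → E × Fin L) × (E × Fin (L + 1))) : ℝ :=
  ∏ ℓ, if c ℓ < knnSqDist k (classIdx (fun i => (ω.1 i).2) ℓ) (fun i => (ω.1 i).1) ω.2.1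
    then 1 else 0

/-! ### Assumptions -/

/-- `c` is the `(1 - α)` quantile of the (squared) distance to `P` under `P`, and is positive. -/
def IsThreshold (P : Measure E) (m α c : ℝ) : Prop :=
  0 < c ∧ IsLeast {s : ℝ | 1 - α ≤ P.real {x | dtmSq P m x ≤ s}} c

/-- `β = √((4/N) ((p + 1) log (2N) + log (8/δ)))`. -/
def betaRate (p N : ℕ) (δ : ℝ) : ℝ :=
  √((4 / (N : ℝ)) * (((p : ℝ) + 1) * Real.log (2 * (N : ℝ)) + Real.log (8 / δ)))

/-- Separation of the anomalies from the class `P`. -/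
def IsSeparated (P Pout : Measure E) (m c C β : ℝ) : Prop :=
  ∃ M τ : ℝ, 2 * c + C * β * (β + √m) ≤ M ∧ τ < m / 2 ∧
    ∀ᵐ x ∂Pout, P.real {z | ‖z - x‖ ^ 2 ≤ M} ≤ τ

/-- Around the spheres of squared radius `r_t(x)`, `0 < t < m`, centred in `S`, the measure `P`
puts enough mass: a small gain of mass forces a small increase of the squared radius. -/
def HasShellMass (P : Measure E) (S : Set E) (m C ε₀ : ℝ) : Prop :=
  ∀ ε, 0 < ε → ε < ε₀ → ∀ η, 0 ≤ η → ∀ x ∈ S, ∀ t, 0 < t → t < m →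
    P.real {z | ‖z - x‖ ^ 2 ≤ sqQuantile P t x + η}
      - P.real {z | ‖z - x‖ ^ 2 ≤ sqQuantile P t x} ≤ ε → η < C * ε

/-- Under `P` the (squared) distance to `P` puts little mass just below the threshold `c`. -/
def HasSmallMargin (P : Measure E) (m c C ε₀ : ℝ) : Prop :=
  ∀ ε, 0 < ε → ε < ε₀ → ∀ κ, κ < C * ε →
    P.real {x | c - κ < dtmSq P m x} - P.real {x | c < dtmSq P m x} ≤ ε

end Test

end

end Anomaly

/-!
Given the labels, the test point `x` is independent of the training points, so `x` may be held
fixed. For fixed `x` everything depends on the law of the squared distance `‖X - x‖²`, whose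
distribution function is `r ↦ P (ball of squared radius r)`, and the balls around `x` form a
chain. Hence no uniformity over centres is needed, and Chernoff's bound for the number of points in
finitely many balls (`measureReal_le_hits_le`, `measureReal_hits_le_le`) replaces any
Vapnik-Chervonenkis argument.

*Level.* The shell condition gives `P (ball of squared radius r_t(x) + C ε) > t + ε` for all
`0 < t < m`. If the empirical mass is nearly right on the finitely many balls of squared radius
`r_{j / J}(x)`, then every empirical quantile is at most `r_t(x) + C ε`, and integration over `t`
bounds the `k`-nearest-neighbour average by `dtmSq P m x + C ε`
(`measureReal_dtmSq_add_lt_knnSqDist_le`). The failure probability is exponentially small in the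
class size, whatever `k` is, and the margin condition turns the shift of the threshold by `C ε` into
a small probability (`exists_forall_measureReal_lt_knnSqDist_le`). For a test point of class `ℓ` it
is enough to look at the factor `ℓ` of the statistic.

*Power.* Iterating the shell condition removes its restriction to small gains
(`HasShellMass.real_ball_add_le`). So around a separated anomaly the ball of squared radius `2 c`
has mass at most `m / 2 - β (β + √m)`, or is null. If the nearest-neighbour average is at most `c`,
then more than half of the `k` neighbours lie in that ball, which has probability at most
`exp (- N β² / 2) ≤ δ`, where `N` is the class size (`measureReal_knnSqDist_le_le`). A union bound
over the classes finishes.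

The passage from the conditional law to product measures is `cond_jointLaw_real_eq`. -/

namespace Anomaly

noncomputable section

set_option linter.unusedSectionVars false

/-! ### Quantiles of the squared distance -/

section Quantile

variable {E : Type*} [NormedAddCommGroup E] [MeasurableSpace E] [BorelSpace E]

/-- Law of the squared distance to `x` of a random point with law `P`. -/
def sqDistLaw (P : Measure E) (x : E) : Measure ℝ := P.map fun z => ‖z - x‖ ^ 2

theorem measurable_sqDist (x : E) : Measurable fun z : E => ‖z - x‖ ^ 2 :=
  (by fun_prop : Continuous fun z : E => ‖z - x‖ ^ 2).measurable

instance (P : Measure E) [IsProbabilityMeasure P] (x : E) :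
    IsProbabilityMeasure (sqDistLaw P x) :=
  Measure.isProbabilityMeasure_map (measurable_sqDist x).aemeasurable

theorem real_ball_eq_cdf (P : Measure E) [IsProbabilityMeasure P] (x : E) (r : ℝ) :
    P.real {z | ‖z - x‖ ^ 2 ≤ r} = cdf (sqDistLaw P x) r := by
  rw [cdf_eq_real, sqDistLaw, map_measureReal_apply (measurable_sqDist x) measurableSet_Iic]
  rfl

variable (P : Measure E) [IsProbabilityMeasure P]

theorem real_ball_mono (x : E) : Monotone fun r : ℝ => P.real {z | ‖z - x‖ ^ 2 ≤ r} :=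
  fun _ _ h => measureReal_mono fun _ hz => le_trans hz h

variable {P}

theorem nonneg_of_lt_real_ball {x : E} {t r : ℝ} (ht : 0 ≤ t)
    (h : t < P.real {z | ‖z - x‖ ^ 2 ≤ r}) : 0 ≤ r := by
  by_contra hr
  have : {z : E | ‖z - x‖ ^ 2 ≤ r} = ∅ := by
    ext z
    simp only [Set.mem_ofPred_eq, Set.mem_empty_iff_false, iff_false, not_le]
    exact lt_of_lt_of_le (not_le.1 hr) (by positivity)
  rw [this, measureReal_empty] at h
  linarith

theorem bddBelow_lt_real_ball {x : E} {t : ℝ} (ht : 0 ≤ t) :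
    BddBelow {r : ℝ | t < P.real {z | ‖z - x‖ ^ 2 ≤ r}} :=
  ⟨0, fun _ h => nonneg_of_lt_real_ball ht h⟩

theorem nonempty_lt_real_ball {x : E} {t : ℝ} (ht : t < 1) :
    {r : ℝ | t < P.real {z | ‖z - x‖ ^ 2 ≤ r}}.Nonempty := by
  simp only [real_ball_eq_cdf]
  exact ((tendsto_cdf_atTop (sqDistLaw P x)).eventually (lt_mem_nhds ht)).exists

theorem sqQuantile_le {x : E} {t r : ℝ} (ht : 0 ≤ t)
    (h : t < P.real {z | ‖z - x‖ ^ 2 ≤ r}) : sqQuantile P t x ≤ r :=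
  csInf_le (bddBelow_lt_real_ball ht) h

/-- By right continuity of the distribution function of the squared distance. -/
theorem le_real_ball_sqQuantile {x : E} {t : ℝ} (ht1 : t < 1) :
    t ≤ P.real {z | ‖z - x‖ ^ 2 ≤ sqQuantile P t x} := by
  rw [real_ball_eq_cdf]
  have hc := ((cdf (sqDistLaw P x)).right_continuous (sqQuantile P t x)).mono_left
    (nhdsWithin_mono _ Set.Ioi_subset_Ici_self)
  refine ge_of_tendsto hc ?_
  filter_upwards [self_mem_nhdsWithin] with r hr
  obtain ⟨s, hs, hsr⟩ := exists_lt_of_csInf_lt (nonempty_lt_real_ball (P := P) (x := x) ht1) hr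
  have := real_ball_mono P x hsr.le
  rw [← real_ball_eq_cdf]
  exact (lt_of_lt_of_le hs this).le

theorem sqQuantile_mono {x : E} {s t : ℝ} (hs : 0 ≤ s) (hst : s ≤ t) (ht : t < 1) :
    sqQuantile P s x ≤ sqQuantile P t x :=
  csInf_le_csInf (bddBelow_lt_real_ball hs) (nonempty_lt_real_ball ht)
    fun _ h => lt_of_le_of_lt hst h

theorem sqQuantile_lt_iff {x : E} {t a : ℝ} (ht : 0 ≤ t) (ht1 : t < 1) :
    sqQuantile P t x < a ↔ ∃ r : ℚ, (r : ℝ) < a ∧ t < P.real {z | ‖z - x‖ ^ 2 ≤ r} := by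
  constructor
  · intro h
    obtain ⟨s, hs, hsa⟩ := exists_lt_of_csInf_lt (nonempty_lt_real_ball (P := P) (x := x) ht1) h
    obtain ⟨r, hr, hra⟩ := exists_rat_btwn hsa
    exact ⟨r, hra, lt_of_lt_of_le hs (real_ball_mono P x hr.le)⟩
  · rintro ⟨r, hra, hr⟩
    exact lt_of_le_of_lt (sqQuantile_le ht hr) hra

theorem intervalIntegrable_sqQuantile {x : E} {m a b : ℝ} (hm : m < 1) (ha : 0 ≤ a)
    (hab : a ≤ b) (hb : b ≤ m) :
    IntervalIntegrable (fun t => sqQuantile P t x) volume a b := by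
  refine MonotoneOn.intervalIntegrable ?_
  rw [Set.uIcc_of_le hab]
  intro s hs t ht hst
  exact sqQuantile_mono (ha.trans hs.1) hst (by linarith [ht.2])

/-! ### Consequences of the shell condition -/

variable {S : Set E} {m C ε₀ : ℝ}

theorem HasShellMass.add_lt (h : HasShellMass P S m C ε₀) {x : E} (hx : x ∈ S) (hC : 0 < C)
    {t ε : ℝ} (ht : 0 < t) (htm : t < m) (hm : m ≤ 1) (hε : 0 < ε) (hε₀ : ε < ε₀) :
    t + ε < P.real {z | ‖z - x‖ ^ 2 ≤ sqQuantile P t x + C * ε} := by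
  by_contra hcon
  have h1 := le_real_ball_sqQuantile (P := P) (x := x) (htm.trans_le hm)
  have := h ε hε hε₀ (C * ε) (by positivity) x hx t ht htm (by linarith)
  exact lt_irrefl _ this

/-- The shell condition excludes the resolution `1`: a ball of mass close to `1` cannot gain a
fixed amount of mass. -/
theorem HasShellMass.resolution_lt_one (h : HasShellMass P S m C ε₀) {x : E} (hx : x ∈ S)
    (hC : 0 < C) (hε₀ : 0 < ε₀) (hm : m ≤ 1) : m < 1 := by
  by_contra hcon
  have hm1 : m = 1 := le_antisymm hm (not_lt.1 hcon)
  have hl := min_le_left (ε₀ / 2) (1 / 2)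
  have hr := min_le_right (ε₀ / 2) (1 / 2)
  have hp : 0 < min (ε₀ / 2) (1 / 2) := by positivity
  generalize min (ε₀ / 2) (1 / 2) = ε at hl hr hp
  have h1 := h.add_lt hx hC (t := 1 - ε) (ε := ε) (by linarith) (by linarith) hm hp (by linarith)
  have h2 : P.real {z | ‖z - x‖ ^ 2 ≤ sqQuantile P (1 - ε) x + C * ε} ≤ 1 := measureReal_le_one
  linarith

theorem HasShellMass.real_ball_add_le_of_lt (h : HasShellMass P S m C ε₀) {x : E} (hx : x ∈ S)
    (hC : 0 < C) (hm : m ≤ 1) {s ε : ℝ} (hε : 0 < ε) (hε₀ : ε < ε₀)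
    (hs : 0 < P.real {z | ‖z - x‖ ^ 2 ≤ s}) (hsm : P.real {z | ‖z - x‖ ^ 2 ≤ s} ≤ m) :
    P.real {z | ‖z - x‖ ^ 2 ≤ s} + ε ≤ P.real {z | ‖z - x‖ ^ 2 ≤ s + C * ε} := by
  refine le_of_forall_lt fun u hu => ?_
  have hlt : max (u - ε) (P.real {z | ‖z - x‖ ^ 2 ≤ s} / 2) < P.real {z | ‖z - x‖ ^ 2 ≤ s} :=
    max_lt (by linarith) (by linarith)
  have hl := le_max_left (u - ε) (P.real {z | ‖z - x‖ ^ 2 ≤ s} / 2)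
  have hr := le_max_right (u - ε) (P.real {z | ‖z - x‖ ^ 2 ≤ s} / 2)
  generalize max (u - ε) (P.real {z | ‖z - x‖ ^ 2 ≤ s} / 2) = t at hlt hl hr
  have h1 := h.add_lt hx hC (t := t) (by linarith) (by linarith) hm hε hε₀
  have h2 := sqQuantile_le (P := P) (x := x) (t := t) (by linarith) hlt
  have h3 := real_ball_mono P x (show sqQuantile P t x + C * ε ≤ s + C * ε by linarith)
  simp only at h3
  linarith

/-- As long as the mass stays below `m`, the shell condition can be iterated, so that its
restriction to gains less than `ε₀` disappears. -/
theorem HasShellMass.real_ball_add_le (h : HasShellMass P S m C ε₀) {x : E} (hx : x ∈ S)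
    (hC : 0 < C) (hε₀ : 0 < ε₀) (hm : m ≤ 1) {s ε : ℝ} (hε : 0 < ε)
    (hs : 0 < P.real {z | ‖z - x‖ ^ 2 ≤ s})
    (hsm : P.real {z | ‖z - x‖ ^ 2 ≤ s + C * ε} ≤ m) :
    P.real {z | ‖z - x‖ ^ 2 ≤ s} + ε ≤ P.real {z | ‖z - x‖ ^ 2 ≤ s + C * ε} := by
  obtain ⟨N, hN⟩ := exists_nat_gt (ε / ε₀)
  have hN0 : (0 : ℝ) < N := lt_trans (by positivity) hN
  have key : ∀ j : ℕ, j ≤ N → P.real {z | ‖z - x‖ ^ 2 ≤ s} + j * (ε / N) ≤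
      P.real {z | ‖z - x‖ ^ 2 ≤ s + C * (j * (ε / N))} := by
    intro j
    induction j with
    | zero => simp
    | succ j ih =>
      intro hj
      have hj' : (j : ℝ) ≤ N := by exact_mod_cast (Nat.le_succ j).trans hj
      have ih := ih ((Nat.le_succ j).trans hj)
      have hle : (j : ℝ) * (ε / N) ≤ ε := by
        rw [mul_div_assoc', div_le_iff₀ hN0]; nlinarith
      have hmono := real_ball_mono P x
        (show s + C * (j * (ε / N)) ≤ s + C * ε by gcongr)
      have hpos : 0 ≤ (j : ℝ) * (ε / N) := by positivity
      have := h.real_ball_add_le_of_lt hx hC hm (s := s + C * (j * (ε / N))) (ε := ε / N)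
        (by positivity) (by rw [div_lt_iff₀ hN0]; rw [div_lt_iff₀ hε₀] at hN; linarith)
        (by linarith) (hmono.trans hsm)
      have e : s + C * (j * (ε / N)) + C * (ε / N) = s + C * (((j + 1 : ℕ) : ℝ) * (ε / N)) := by
        push_cast; ring
      rw [e] at this
      push_cast at this ⊢
      linarith
  have := key N le_rfl
  rwa [mul_div_cancel₀ _ hN0.ne'] at this

end Quantile

/-! ### Nearest neighbours and empirical quantiles -/

section Neighbours

/-- If every level `g t`, `0 < t < k / N`, is at least the empirical `t`-quantile of the `N` numbers
`d i`, then the `k` smallest of them sum up to at most `N ∫ g`: compare the `j`-th smallest number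
with `g` on the interval `(j / N, (j + 1) / N)`. -/
theorem exists_card_eq_sum_le_integral {n k : ℕ} (I : Finset (Fin n)) (d : Fin n → ℝ) (g : ℝ → ℝ)
    (hk : k ≤ I.card)
    (hg : ∀ a b : ℝ, 0 ≤ a → a ≤ b → b ≤ k / I.card → IntervalIntegrable g volume a b)
    (h : ∀ t : ℝ, 0 < t → t < k / I.card →
      t * I.card < ((I.filter fun i => d i ≤ g t).card : ℝ)) :
    ∃ s ⊆ I, s.card = k ∧ ∑ i ∈ s, d i ≤ I.card * ∫ t in (0 : ℝ)..(k / I.card), g t := by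
  classical
  rcases Nat.eq_zero_or_pos k with rfl | hk0
  · exact ⟨∅, by simp, by simp, by simp⟩
  have hN : (0 : ℝ) < I.card := by exact_mod_cast hk0.trans_le hk
  set N := I.card with hNdef
  set u : Fin N → Fin n := fun j => ((I.equivFin).symm j : Fin n) with hu
  have hu_inj : Function.Injective u :=
    Subtype.val_injective.comp (I.equivFin).symm.injective
  have hu_mem : ∀ j, u j ∈ I := fun j => ((I.equivFin).symm j).2
  set σ := Tuple.sort (d ∘ u) with hσ
  have hmono : Monotone ((d ∘ u) ∘ σ) := Tuple.monotone_sort _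
  set v : Fin N → Fin n := fun j => u (σ j) with hv
  have hv_inj : Function.Injective v := hu_inj.comp σ.injective
  have hv_surj : ∀ i ∈ I, ∃ j, v j = i := by
    intro i hi
    refine ⟨σ.symm (I.equivFin ⟨i, hi⟩), ?_⟩
    simp [hv, hu]
  -- the `j`-th smallest number is at most `g t` for `t` between `j / N` and `(j + 1) / N`
  have hle : ∀ j : Fin N, (j : ℕ) < k → ∀ t : ℝ, (j : ℝ) / N < t → t < ((j : ℕ) + 1 : ℝ) / N →
      d (v j) ≤ g t := by
    intro j hj t ht1 ht2
    by_contra hlt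
    rw [not_le] at hlt
    have hjk : ((j : ℕ) + 1 : ℝ) ≤ k := by exact_mod_cast hj
    have hcount := h t (lt_of_le_of_lt (by positivity) ht1)
      (ht2.trans_le (by gcongr))
    rw [div_lt_iff₀ hN] at ht1
    have hsub : (I.filter fun i => d i ≤ g t) ⊆ (Finset.Iio j).image v := by
      intro i hi
      rw [Finset.mem_filter] at hi
      obtain ⟨l, rfl⟩ := hv_surj i hi.1
      refine Finset.mem_image_of_mem _ (Finset.mem_Iio.2 ?_)
      by_contra hl
      have : d (v j) ≤ d (v l) := hmono (not_lt.1 hl)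
      linarith [hi.2]
    have hcard := (Finset.card_le_card hsub).trans Finset.card_image_le
    rw [Fin.card_Iio] at hcard
    have : ((I.filter fun i => d i ≤ g t).card : ℝ) ≤ j := by exact_mod_cast hcard
    linarith
  set v' : Fin k → Fin n := fun j => v (Fin.castLE hk j) with hv'
  have hv'_inj : Function.Injective v' := hv_inj.comp (Fin.castLE_injective hk)
  refine ⟨Finset.univ.image v', ?_, ?_, ?_⟩
  · intro i hi
    obtain ⟨j, -, rfl⟩ := Finset.mem_image.1 hi
    exact hu_mem _
  · rw [Finset.card_image_of_injective _ hv'_inj, Finset.card_univ, Fintype.card_fin]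
  · rw [Finset.sum_image fun a _ b _ hab => hv'_inj hab]
    have hint : ∀ j < k, IntervalIntegrable g volume ((j : ℕ) / (N : ℝ)) ((j + 1 : ℕ) / (N : ℝ)) := by
      intro j hj
      refine hg _ _ (by positivity) (by gcongr; exact Nat.le_succ j) ?_
      gcongr
      exact hj
    have hsum := intervalIntegral.sum_integral_adjacent_intervals
      (f := g) (a := fun j : ℕ => (j : ℝ) / N) (μ := volume) hint
    simp only [Nat.cast_zero, zero_div] at hsum
    rw [← hsum, Finset.mul_sum, Finset.sum_range]
    refine Finset.sum_le_sum fun j _ => ?_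
    have hab : ((j : ℕ) : ℝ) / N ≤ ((j + 1 : ℕ) : ℝ) / N := by gcongr; exact Nat.le_succ _
    have hi : ∫ _ in (((j : ℕ) : ℝ) / N)..(((j : ℕ) + 1 : ℕ) : ℝ) / N, d (v' j) ≤
        ∫ t in (((j : ℕ) : ℝ) / N)..(((j : ℕ) + 1 : ℕ) : ℝ) / N, g t := by
      refine intervalIntegral.integral_mono_on_of_le_Ioo hab (by simp) (hint j j.2) fun t ht => ?_
      refine hle (Fin.castLE hk j) j.2 t ht.1 ?_
      have := ht.2
      push_cast at this
      exact this
    rw [intervalIntegral.integral_const, smul_eq_mul, ← sub_div] at hi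
    push_cast at hi ⊢
    rw [add_sub_cancel_left] at hi
    calc d (v' j) = N * (1 / N * d (v' j)) := by field_simp
      _ ≤ _ := mul_le_mul_of_nonneg_left hi hN.le

variable {E : Type*} [NormedAddCommGroup E] {n k : ℕ} {I : Finset (Fin n)} {X : Fin n → E} {x : E}

theorem finite_avgSqDist (k : ℕ) (I : Finset (Fin n)) (X : Fin n → E) (x : E) :
    (avgSqDist k X x '' {s : Finset (Fin n) | s ⊆ I ∧ s.card = k}).Finite :=
  (Set.toFinite _).image _

theorem knnSqDist_le {s : Finset (Fin n)} (hs : s ⊆ I) (hsk : s.card = k) :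
    knnSqDist k I X x ≤ avgSqDist k X x s :=
  csInf_le (finite_avgSqDist k I X x).bddBelow ⟨s, ⟨hs, hsk⟩, rfl⟩

theorem exists_knnSqDist_eq (hk : k ≤ I.card) :
    ∃ s ⊆ I, s.card = k ∧ knnSqDist k I X x = avgSqDist k X x s := by
  obtain ⟨s, hs, hsk⟩ := Finset.exists_subset_card_eq hk
  obtain ⟨u, hu, h⟩ := Set.Nonempty.csInf_mem (s := avgSqDist k X x '' {s | s ⊆ I ∧ s.card = k})
    ⟨_, s, ⟨hs, hsk⟩, rfl⟩ (finite_avgSqDist k I X x)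
  exact ⟨u, hu.1, hu.2, h.symm⟩

/-- Markov's inequality for the `k` nearest neighbours: if their mean squared distance is at most
`c`, then more than half of them lie within squared distance `2 c`. -/
theorem lt_two_mul_card_of_knnSqDist_le (hk : 1 ≤ k) (hkI : k ≤ I.card) {c : ℝ} (hc : 0 < c)
    (h : knnSqDist k I X x ≤ c) :
    k < 2 * (I.filter fun i => ‖X i - x‖ ^ 2 ≤ 2 * c).card := by
  classical
  obtain ⟨s, hs, hsk, hsum⟩ := exists_knnSqDist_eq (X := X) (x := x) hkI
  rw [hsum, avgSqDist, one_div, inv_mul_le_iff₀ (by exact_mod_cast hk)] at h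
  by_contra hcon
  have hle := Finset.card_le_card (Finset.filter_subset_filter
    (fun i => ‖X i - x‖ ^ 2 ≤ 2 * c) hs)
  have hadd := Finset.card_filter_add_card_filter_not (s := s) fun i => ‖X i - x‖ ^ 2 ≤ 2 * c
  have hfar : k ≤ 2 * (s.filter fun i => ¬ ‖X i - x‖ ^ 2 ≤ 2 * c).card := by omega
  have hpos : (s.filter fun i => ¬ ‖X i - x‖ ^ 2 ≤ 2 * c).Nonempty := by
    rw [← Finset.card_pos]; omega
  have h1 : ∑ i ∈ s.filter (fun i => ¬ ‖X i - x‖ ^ 2 ≤ 2 * c), 2 * c <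
      ∑ i ∈ s.filter (fun i => ¬ ‖X i - x‖ ^ 2 ≤ 2 * c), ‖X i - x‖ ^ 2 :=
    Finset.sum_lt_sum_of_nonempty hpos fun i hi => not_le.1 (Finset.mem_filter.1 hi).2
  have h2 := Finset.sum_le_sum_of_subset_of_nonneg
    (Finset.filter_subset (fun i => ¬ ‖X i - x‖ ^ 2 ≤ 2 * c) s)
    (f := fun i => ‖X i - x‖ ^ 2) fun i _ _ => by positivity
  rw [Finset.sum_const, nsmul_eq_mul] at h1
  have h3 : (k : ℝ) ≤ 2 * (s.filter fun i => ¬ ‖X i - x‖ ^ 2 ≤ 2 * c).card := by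
    exact_mod_cast hfar
  nlinarith

/-- If for all `0 < t < m` the empirical mass of the ball of squared radius `r_t(x) + a` exceeds
`t`, then the empirical squared distance to the measure exceeds the true one by at most `a`. -/
theorem knnSqDist_le_dtmSq_add [MeasurableSpace E] [BorelSpace E] {P : Measure E}
    [IsProbabilityMeasure P] (hk : 1 ≤ k) (hkI : k ≤ I.card) (hm : (k / I.card : ℝ) < 1) {a : ℝ}
    (h : ∀ t : ℝ, 0 < t → t < k / I.card →
      t * I.card < ((I.filter fun i => ‖X i - x‖ ^ 2 ≤ sqQuantile P t x + a).card : ℝ)) :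
    knnSqDist k I X x ≤ dtmSq P (k / I.card) x + a := by
  have hq : ∀ u v : ℝ, 0 ≤ u → u ≤ v → v ≤ k / I.card →
      IntervalIntegrable (fun t => sqQuantile P t x) volume u v :=
    fun u v hu huv hv => intervalIntegrable_sqQuantile hm hu huv hv
  obtain ⟨s, hs, hsk, hsum⟩ := exists_card_eq_sum_le_integral I (fun i => ‖X i - x‖ ^ 2)
    (fun t => sqQuantile P t x + a) hkI
    (fun u v hu huv hv => (hq u v hu huv hv).add (by simp)) h
  refine (knnSqDist_le hs hsk).trans ?_
  have hk0 : (0 : ℝ) < k := by exact_mod_cast hk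
  have hN : (0 : ℝ) < I.card := by exact_mod_cast hk.trans hkI
  rw [intervalIntegral.integral_add (hq 0 _ le_rfl (by positivity) le_rfl) (by simp),
    intervalIntegral.integral_const, smul_eq_mul, sub_zero] at hsum
  rw [avgSqDist, dtmSq]
  calc _ ≤ 1 / (k : ℝ) * _ := mul_le_mul_of_nonneg_left hsum (by positivity)
    _ = _ := by field_simp

variable [MeasurableSpace E] [BorelSpace E] [SecondCountableTopology E]

theorem measurable_knnSqDist (k : ℕ) (I : Finset (Fin n)) :
    Measurable fun z : (Fin n → E) × E => knnSqDist k I z.1 z.2 := by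
  unfold knnSqDist
  simp only [sInf_image']
  refine Measurable.iInf fun s => ?_
  unfold avgSqDist
  fun_prop

/-- `(x, t) ↦ r_t(x)` is jointly measurable for `0 ≤ t < 1`, since `r_t(x) < a` means that
some ball of rational squared radius less than `a` has mass more than `t`. -/
theorem measurable_dtmSq (P : Measure E) [IsProbabilityMeasure P] {m : ℝ} (hm0 : 0 ≤ m)
    (hm : m < 1) : Measurable (dtmSq P m) := by
  have hball : ∀ r : ℝ, Measurable fun x : E => P.real {z | ‖z - x‖ ^ 2 ≤ r} := by
    intro r
    have hs : MeasurableSet {z : E × E | ‖z.2 - z.1‖ ^ 2 ≤ r} :=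
      measurableSet_le (by fun_prop) measurable_const
    exact (measurable_measure_prodMk_left (ν := P) hs).ennreal_toReal
  have hclip : ∀ t : ℝ, 0 ≤ max 0 (min t m) ∧ max 0 (min t m) < 1 := fun t =>
    ⟨le_max_left _ _, max_lt one_pos ((min_le_right _ _).trans_lt hm)⟩
  have hmeas : Measurable (Function.uncurry fun (x : E) (t : ℝ) =>
      sqQuantile P (max 0 (min t m)) x) := by
    refine measurable_of_Iio fun a => ?_
    have : (Function.uncurry fun (x : E) (t : ℝ) => sqQuantile P (max 0 (min t m)) x) ⁻¹'
        Set.Iio a = ⋃ r : ℚ, {z : E × ℝ | (r : ℝ) < a ∧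
          max 0 (min z.2 m) < P.real {y | ‖y - z.1‖ ^ 2 ≤ r}} := by
      ext z
      simp only [Set.mem_preimage, Set.mem_Iio, Set.mem_iUnion]
      exact sqQuantile_lt_iff (hclip z.2).1 (hclip z.2).2
    rw [this]
    refine MeasurableSet.iUnion fun r => MeasurableSet.inter (MeasurableSet.const _) ?_
    exact measurableSet_lt (by fun_prop) ((hball r).comp measurable_fst)
  have heq : dtmSq P m = fun x => (1 / m) * ∫ t in Set.Ioc 0 m,
      sqQuantile P (max 0 (min t m)) x := by
    ext x
    rw [dtmSq, intervalIntegral.integral_of_le hm0]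
    congr 1
    refine setIntegral_congr_fun measurableSet_Ioc fun t ht => ?_
    simp only [min_eq_left ht.2, max_eq_right ht.1.le]
  rw [heq]
  exact (hmeas.stronglyMeasurable.integral_prod_right
    (ν := volume.restrict (Set.Ioc 0 m))).measurable.const_mul _

end Neighbours

/-! ### A Chernoff bound for empirical masses -/

section Chernoff

variable {E : Type*} [MeasurableSpace E] {n : ℕ}

open Classical in
/-- Number of the points `X i`, `i ∈ I`, that lie in `B`. -/
def hits (I : Finset (Fin n)) (B : Set E) (X : Fin n → E) : ℕ := (I.filter fun i => X i ∈ B).card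

theorem measurable_hits (I : Finset (Fin n)) {B : Set E} (hB : MeasurableSet B) :
    Measurable fun X : Fin n → E => (hits I B X : ℝ) := by
  classical
  simp only [hits, Finset.card_filter, Nat.cast_sum, Nat.cast_ite, Nat.cast_one, Nat.cast_zero]
  exact Finset.measurable_fun_sum _ fun i _ =>
    Measurable.ite (measurable_pi_apply i hB) measurable_const measurable_const

variable (Q : Fin n → Measure E) [∀ i, IsProbabilityMeasure (Q i)] {P : Measure E}
  [IsProbabilityMeasure P] {I : Finset (Fin n)} {B : Set E}

theorem integrable_exp_mul_hits (hB : MeasurableSet B) (l : ℝ) :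
    Integrable (fun X : Fin n → E => Real.exp (l * hits I B X)) (Measure.pi Q) := by
  refine Integrable.of_bound
    ((measurable_hits I hB).const_mul l).exp.aestronglyMeasurable (Real.exp (|l| * I.card))
    (ae_of_all _ fun X => ?_)
  rw [Real.norm_eq_abs, abs_of_pos (Real.exp_pos _), Real.exp_le_exp]
  have h1 : (hits I B X : ℝ) ≤ I.card := by
    classical
    exact_mod_cast Finset.card_filter_le _ _
  exact mul_le_mul (le_abs_self l) h1 (by positivity) (abs_nonneg l)

/-- Moment generating function of the number of hits, a binomial variable, for `|l| ≤ 1`; it uses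
`exp l ≤ 1 + l + l ^ 2`. -/
theorem mgf_hits_le (hQ : ∀ i ∈ I, Q i = P) (hB : MeasurableSet B) {l : ℝ} (hl : |l| ≤ 1) :
    mgf (fun X => (hits I B X : ℝ)) (Measure.pi Q) l ≤
      Real.exp (I.card * P.real B * (l + l ^ 2)) := by
  classical
  have hprod : ∀ X : Fin n → E, Real.exp (l * hits I B X) =
      ∏ i, if i ∈ I then (if X i ∈ B then Real.exp l else 1) else 1 := by
    intro X
    rw [Finset.prod_ite_mem, Finset.univ_inter, Finset.prod_ite, Finset.prod_const,
      Finset.prod_const_one, mul_one, mul_comm, Real.exp_nat_mul]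
    rfl
  have hI : ∀ i ∈ I, ∫ z, (if z ∈ B then Real.exp l else 1) ∂(Q i) ≤
      Real.exp (P.real B * (l + l ^ 2)) := by
    intro i hi
    rw [hQ i hi]
    have : (fun z => if z ∈ B then Real.exp l else 1) =
        fun z => 1 + B.indicator (fun _ => Real.exp l - 1) z := by
      ext z
      by_cases hz : z ∈ B <;> simp [hz]
    rw [this, integral_add (integrable_const _) ((integrable_const _).indicator hB),
      integral_indicator_const _ hB, integral_const, smul_eq_mul, smul_eq_mul, probReal_univ,
      one_mul]
    have h1 := (abs_le.1 (Real.abs_exp_sub_one_sub_id_le hl)).2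
    have h2 := Real.add_one_le_exp (P.real B * (l + l ^ 2))
    have h3 : P.real B * (Real.exp l - 1) ≤ P.real B * (l + l ^ 2) :=
      mul_le_mul_of_nonneg_left (by linarith) measureReal_nonneg
    linarith
  rw [mgf]
  simp only [hprod]
  rw [integral_fintype_prod_eq_prod
    (f := fun i z => if i ∈ I then (if z ∈ B then Real.exp l else 1) else (1 : ℝ))]
  calc ∏ i, ∫ z, (if i ∈ I then (if z ∈ B then Real.exp l else 1) else (1 : ℝ)) ∂(Q i)
      = ∏ i ∈ I, ∫ z, (if z ∈ B then Real.exp l else (1 : ℝ)) ∂(Q i) := by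
        rw [← Finset.univ_inter I, ← Finset.prod_ite_mem, Finset.univ_inter]
        refine Finset.prod_congr rfl fun i _ => ?_
        by_cases hi : i ∈ I <;> simp [hi]
    _ ≤ ∏ _i ∈ I, Real.exp (P.real B * (l + l ^ 2)) := by
        refine Finset.prod_le_prod (fun i _ => integral_nonneg fun z => ?_) hI
        simp only [Pi.zero_apply]
        split_ifs <;> positivity
    _ = _ := by rw [Finset.prod_const, ← Real.exp_nat_mul, mul_assoc]

theorem measureReal_le_hits_le (hQ : ∀ i ∈ I, Q i = P) (hB : MeasurableSet B) {l : ℝ} (hl : 0 ≤ l)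
    (hl1 : l ≤ 1) (a : ℝ) :
    (Measure.pi Q).real {X | a ≤ hits I B X} ≤
      Real.exp (I.card * P.real B * (l + l ^ 2) - l * a) := by
  refine (measure_ge_le_exp_mul_mgf a hl (integrable_exp_mul_hits Q hB l)).trans ?_
  rw [sub_eq_neg_add, Real.exp_add, ← neg_mul]
  exact mul_le_mul_of_nonneg_left (mgf_hits_le Q hQ hB (abs_le.2 ⟨by linarith, hl1⟩))
    (Real.exp_pos _).le

theorem measureReal_hits_le_le (hQ : ∀ i ∈ I, Q i = P) (hB : MeasurableSet B) {l : ℝ} (hl : 0 ≤ l)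
    (hl1 : l ≤ 1) (a : ℝ) :
    (Measure.pi Q).real {X | (hits I B X : ℝ) ≤ a} ≤
      Real.exp (I.card * P.real B * (-l + l ^ 2) + l * a) := by
  refine (measure_le_le_exp_mul_mgf a (neg_nonpos.2 hl)
    (integrable_exp_mul_hits Q hB (-l))).trans ?_
  rw [add_comm, Real.exp_add, neg_neg]
  have := mgf_hits_le Q hQ hB (l := -l) (abs_le.2 ⟨by linarith, by linarith⟩)
  rw [neg_sq] at this
  exact mul_le_mul_of_nonneg_left this (Real.exp_pos _).le

end Chernoff

/-! ### Deviation bounds at a fixed point -/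

section FixedPoint

variable {E : Type*} [NormedAddCommGroup E] [MeasurableSpace E] [BorelSpace E] {n k : ℕ}

theorem measurableSet_sqDist_le (x : E) (r : ℝ) : MeasurableSet {z : E | ‖z - x‖ ^ 2 ≤ r} :=
  measurable_sqDist x measurableSet_Iic

theorem hits_sqDist_le (I : Finset (Fin n)) (X : Fin n → E) (x : E) (r : ℝ) :
    hits I {z | ‖z - x‖ ^ 2 ≤ r} X = (I.filter fun i => ‖X i - x‖ ^ 2 ≤ r).card := by
  unfold hits
  congr

variable (Q : Fin n → Measure E) [∀ i, IsProbabilityMeasure (Q i)] {P : Measure E}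
  [IsProbabilityMeasure P] {I : Finset (Fin n)} {S : Set E} {C ε₀ : ℝ} {x : E}

/-- The empirical squared distance to the measure rarely exceeds the true one by much. The levels
`r_t(x)`, `0 < t < m`, are controlled through the finitely many balls of squared radius
`r_{j / J}(x)`: the shell condition places one of them, of mass more than `t + 1 / J`, inside the
ball of squared radius `r_t(x) + 2 C / J`. -/
theorem measureReal_dtmSq_add_lt_knnSqDist_le (hQ : ∀ i ∈ I, Q i = P) (hk : 1 ≤ k)
    (hkI : k ≤ I.card) (hsh : HasShellMass P S (k / I.card) C ε₀) (hx : x ∈ S) (hC : 0 < C)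
    {J : ℕ} (hJ : 0 < J) (hJε : 2 / (J : ℝ) < ε₀) :
    (Measure.pi Q).real {X | dtmSq P (k / I.card) x + C * (2 / J) < knnSqDist k I X x} ≤
      J * Real.exp (-(I.card / (4 * (J : ℝ) ^ 2))) := by
  have hJ0 : (0 : ℝ) < J := by exact_mod_cast hJ
  have hJ1 : (1 : ℝ) ≤ J := by exact_mod_cast hJ
  have hN : (0 : ℝ) < I.card := by exact_mod_cast hk.trans hkI
  have hm : (k / I.card : ℝ) ≤ 1 := by
    rw [div_le_one hN]; exact_mod_cast hkI
  have hm1 := hsh.resolution_lt_one hx hC (lt_trans (by positivity) hJε) hm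
  set bad : ℕ → Set (Fin n → E) := fun j =>
    {X | (hits I {z | ‖z - x‖ ^ 2 ≤ sqQuantile P (j / J) x} X : ℝ) ≤ I.card * ((j - 1) / J)}
    with hbad
  have hsub : {X | dtmSq P (k / I.card) x + C * (2 / J) < knnSqDist k I X x} ⊆
      ⋃ j ∈ Finset.range J, bad j := by
    intro X hX
    by_contra hcon
    simp only [Set.mem_iUnion, Finset.mem_range, not_exists] at hcon
    refine not_le.2 hX (knnSqDist_le_dtmSq_add hk hkI hm1 fun t ht htm => ?_)
    have h1 := hsh.add_lt hx hC ht htm hm (by positivity) hJε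
    have h2 : P.real {z | ‖z - x‖ ^ 2 ≤ sqQuantile P t x + C * (2 / J)} ≤ 1 := measureReal_le_one
    have hf1 := Nat.floor_le (show 0 ≤ t * J by positivity)
    have hf2 := Nat.lt_floor_add_one (t * J)
    have hle : ((⌊t * J⌋₊ + 2 : ℕ) : ℝ) / J ≤ t + 2 / J := by
      rw [div_le_iff₀ hJ0, add_mul, div_mul_cancel₀ _ hJ0.ne']
      push_cast; linarith
    have hjJ : ⌊t * J⌋₊ + 2 < J := by
      have : ((⌊t * J⌋₊ + 2 : ℕ) : ℝ) / J < 1 := by linarith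
      rw [div_lt_one hJ0] at this
      exact_mod_cast this
    have hb := hcon _ hjJ
    have hq := sqQuantile_le (P := P) (x := x) (by positivity) (lt_of_le_of_lt hle h1)
    rw [← hits_sqDist_le]
    have hb' : (I.card : ℝ) * ((((⌊t * J⌋₊ + 2 : ℕ) : ℝ) - 1) / J) <
        hits I {z | ‖z - x‖ ^ 2 ≤ sqQuantile P (((⌊t * J⌋₊ + 2 : ℕ) : ℝ) / J) x} X := not_le.1 hb
    have hmono : hits I {z | ‖z - x‖ ^ 2 ≤ sqQuantile P (((⌊t * J⌋₊ + 2 : ℕ) : ℝ) / J) x} X ≤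
        hits I {z | ‖z - x‖ ^ 2 ≤ sqQuantile P t x + C * (2 / J)} X := by
      rw [hits_sqDist_le, hits_sqDist_le]
      exact Finset.card_le_card (Finset.monotone_filter_right _ fun i _ hi => le_trans hi hq)
    have hmono' : (hits I {z | ‖z - x‖ ^ 2 ≤
        sqQuantile P (((⌊t * J⌋₊ + 2 : ℕ) : ℝ) / J) x} X : ℝ) ≤
        hits I {z | ‖z - x‖ ^ 2 ≤ sqQuantile P t x + C * (2 / J)} X := by exact_mod_cast hmono
    refine lt_of_lt_of_le (lt_trans ?_ hb') hmono'
    rw [mul_comm]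
    refine mul_lt_mul_of_pos_left ?_ hN
    rw [lt_div_iff₀ hJ0]
    push_cast; linarith
  have hbound : ∀ j ∈ Finset.range J, (Measure.pi Q).real (bad j) ≤
      Real.exp (-(I.card / (4 * (J : ℝ) ^ 2))) := by
    intro j hj
    have hjJ : (j : ℝ) < J := by exact_mod_cast Finset.mem_range.1 hj
    have hj1 : (j : ℝ) / J < 1 := by rwa [div_lt_one hJ0]
    have hP := le_real_ball_sqQuantile (P := P) (x := x) hj1
    -- the exponent is optimised at `l = 1 / (2 J)`
    set l : ℝ := 1 / (2 * J) with hl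
    have hl0 : 0 < l := by positivity
    have hl1 : l ≤ 1 := by rw [hl, div_le_one (by positivity)]; linarith
    have hlJ : 1 / (J : ℝ) = 2 * l := by rw [hl]; field_simp
    refine (measureReal_hits_le_le Q hQ (measurableSet_sqDist_le x _) hl0.le hl1 _).trans ?_
    rw [Real.exp_le_exp]
    have e1 : ((I.card : ℝ) / (4 * (J : ℝ) ^ 2)) = I.card * l ^ 2 := by rw [hl]; field_simp; norm_num
    have e2 : (((j : ℝ) - 1) / J) = j / J - 2 * l := by rw [← hlJ]; ring
    rw [e1, e2, mul_assoc, mul_left_comm l, ← mul_add, ← mul_neg]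
    refine mul_le_mul_of_nonneg_left ?_ hN.le
    nlinarith [mul_nonneg hl0.le (sub_nonneg.2 hl1), mul_le_mul_of_nonneg_right hP
      (mul_nonneg hl0.le (sub_nonneg.2 hl1)), mul_nonneg (sub_nonneg.2 hj1.le) (sq_nonneg l)]
  calc _ ≤ (Measure.pi Q).real (⋃ j ∈ Finset.range J, bad j) :=
        measureReal_mono hsub (measure_ne_top _ _)
    _ ≤ ∑ j ∈ Finset.range J, (Measure.pi Q).real (bad j) := measureReal_biUnion_finset_le _ _
    _ ≤ ∑ j ∈ Finset.range J, Real.exp (-(I.card / (4 * (J : ℝ) ^ 2))) :=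
        Finset.sum_le_sum hbound
    _ = _ := by simp

theorem betaRate_pos {p N : ℕ} {δ : ℝ} (hN : 1 ≤ N) (hδ : 0 < δ) (hδ1 : δ < 1) :
    0 < betaRate p N δ := by
  have hN' : (1 : ℝ) ≤ N := by exact_mod_cast hN
  have h1 : 0 ≤ Real.log (2 * N) := Real.log_nonneg (by linarith)
  have h2 : 0 < Real.log (8 / δ) := Real.log_pos (by rw [lt_div_iff₀ hδ]; linarith)
  exact Real.sqrt_pos.2 (by positivity)

theorem exp_neg_mul_betaRate_sq_le {p N : ℕ} {δ : ℝ} (hN : 1 ≤ N) (hδ : 0 < δ) (hδ1 : δ < 1) :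
    Real.exp (-(N * betaRate p N δ ^ 2 / 2)) ≤ δ := by
  have hN' : (1 : ℝ) ≤ N := by exact_mod_cast hN
  have h1 : 0 ≤ Real.log (2 * N) := Real.log_nonneg (by linarith)
  have h2 : 0 < Real.log (8 / δ) := Real.log_pos (by rw [lt_div_iff₀ hδ]; linarith)
  rw [betaRate, Real.sq_sqrt (by positivity), ← Real.le_log_iff_exp_le hδ]
  have h3 : Real.log (8 / δ) = Real.log 8 - Real.log δ :=
    Real.log_div (by norm_num) hδ.ne'
  have h4 : 0 ≤ Real.log 8 := Real.log_nonneg (by norm_num)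
  have h5 : 0 ≤ ((p : ℝ) + 1) * Real.log (2 * N) := by positivity
  have e : (N : ℝ) * (4 / N * (((p : ℝ) + 1) * Real.log (2 * N) + Real.log (8 / δ))) / 2 =
      2 * (((p : ℝ) + 1) * Real.log (2 * N) + Real.log (8 / δ)) := by
    field_simp; norm_num
  rw [e]
  linarith

/-- A point separated from the class is rarely close to it empirically. By the shell condition the
ball of squared radius `2 c` has mass at most `m / 2 - β (β + √m)`, unless it is null, while an
empirical distance at most `c` forces its empirical mass above `m / 2`. -/
theorem measureReal_knnSqDist_le_le (hQ : ∀ i ∈ I, Q i = P) (hk : 1 ≤ k)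
    (hkI : k ≤ I.card) (hsh : HasShellMass P S (k / I.card) C ε₀) (hx : x ∈ S) (hC : 0 < C)
    (hε₀ : 0 < ε₀) {c M τ δ : ℝ} {p : ℕ} (hc : 0 < c) (hδ : 0 < δ) (hδ1 : δ < 1)
    (hM : 2 * c + C * betaRate p I.card δ * (betaRate p I.card δ + √(k / I.card)) ≤ M)
    (hτ : τ < (k / I.card : ℝ) / 2) (hMτ : P.real {z | ‖z - x‖ ^ 2 ≤ M} ≤ τ) :
    (Measure.pi Q).real {X | knnSqDist k I X x ≤ c} ≤ δ := by
  have hN : (0 : ℝ) < I.card := by exact_mod_cast hk.trans hkI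
  have hk0 : (0 : ℝ) < k := by exact_mod_cast hk
  have hβ := betaRate_pos (p := p) (hk.trans hkI) hδ hδ1
  have hexp := exp_neg_mul_betaRate_sq_le (p := p) (hk.trans hkI) hδ hδ1
  set β := betaRate p I.card δ
  have hm : (k / I.card : ℝ) ≤ 1 := by
    rw [div_le_one hN]; exact_mod_cast hkI
  have hm0 : 0 < (k / I.card : ℝ) := by positivity
  set m : ℝ := k / I.card
  set B : Set E := {z | ‖z - x‖ ^ 2 ≤ 2 * c} with hB
  have hBm : MeasurableSet B := measurableSet_sqDist_le x _
  have hsub : {X | knnSqDist k I X x ≤ c} ⊆ {X | (k : ℝ) / 2 ≤ hits I B X} := by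
    intro X hX
    have := lt_two_mul_card_of_knnSqDist_le hk hkI hc hX
    rw [← hits_sqDist_le] at this
    have : (k : ℝ) < 2 * hits I B X := by exact_mod_cast this
    rw [Set.mem_ofPred_eq]
    linarith
  refine (measureReal_mono hsub).trans ?_
  rcases (measureReal_nonneg : 0 ≤ P.real B).eq_or_lt with h0 | h0
  · have hae : ∀ᵐ X ∂Measure.pi Q, ∀ i ∈ I, X i ∉ B := by
      rw [ae_all_iff]
      intro i
      by_cases hi : i ∈ I
      · have : ∀ᵐ z ∂Q i, z ∉ B := by
          rw [hQ i hi, ← measure_eq_zero_iff_ae_notMem]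
          exact (measureReal_eq_zero_iff).1 h0.symm
        filter_upwards [(Measure.tendsto_eval_ae_ae (μ := Q) (i := i)).eventually this] with X hX _
        exact hX
      · exact ae_of_all _ fun X h => absurd h hi
    have : (Measure.pi Q) {X | (k : ℝ) / 2 ≤ hits I B X} = 0 := by
      rw [measure_eq_zero_iff_ae_notMem]
      filter_upwards [hae] with X hX h
      have : hits I B X = 0 := by
        classical
        rw [hits, Finset.card_eq_zero, Finset.filter_eq_empty_iff]
        exact fun i hi => hX i hi
      rw [this, Nat.cast_zero] at h
      linarith
    rw [measureReal_def, this]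
    exact hδ.le
  · have hsq : √m ^ 2 = m := Real.sq_sqrt hm0.le
    have hs0 : 0 < √m := Real.sqrt_pos.2 hm0
    set s := √m
    have hu : 0 < β * (β + s) := by positivity
    have hmono := real_ball_mono P x (show 2 * c + C * (β * (β + s)) ≤ M by
      rw [← mul_assoc]; exact hM)
    simp only at hmono
    have hgain := hsh.real_ball_add_le hx hC hε₀ hm hu h0 (by linarith)
    have ha : P.real B + β * (β + s) ≤ m / 2 := by
      have e : P.real B = P.real {z | ‖z - x‖ ^ 2 ≤ 2 * c} := rfl
      rw [e]; linarith
    have hβs : β ≤ s := by nlinarith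
    have hl1 : β / s ≤ 1 := (div_le_one hs0).2 hβs
    have hl0 : 0 < β / s := by positivity
    -- `l = β / √m` makes the exponent at most `- N β² / 2`
    refine (measureReal_le_hits_le Q hQ hBm hl0.le hl1 _).trans
      (le_trans (Real.exp_le_exp.2 ?_) hexp)
    have hls : β / s * s = β := div_mul_cancel₀ _ hs0.ne'
    set l := β / s
    have h1 : P.real B * (l + l ^ 2) ≤ (m / 2 - β * (β + s)) * (l + l ^ 2) :=
      mul_le_mul_of_nonneg_right (by linarith) (by positivity)
    have h2 : (m / 2 - β * (β + s)) * (l + l ^ 2) - l * (m / 2) ≤ -(β ^ 2 / 2) := by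
      have e : (m / 2 - β * (β + s)) * (l + l ^ 2) - l * (m / 2) =
          (l * s) ^ 2 / 2 - β * (l * s) - β ^ 2 * l - β * (β + s) * l ^ 2 := by
        rw [← hsq]; ring
      rw [e, hls]
      have : 0 ≤ β ^ 2 * l + β * (β + s) * l ^ 2 := by positivity
      linarith
    have hkm : (k : ℝ) = I.card * m := (mul_div_cancel₀ _ hN.ne').symm
    calc I.card * P.real B * (l + l ^ 2) - l * (k / 2)
        = I.card * (P.real B * (l + l ^ 2) - l * (m / 2)) := by rw [hkm]; ring
      _ ≤ I.card * (-(β ^ 2 / 2)) := mul_le_mul_of_nonneg_left (by linarith) hN.le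
      _ = _ := by ring

end FixedPoint

/-! ### The law of the positions given the labels -/

section Disintegration

variable {E : Type*} [MeasurableSpace E] {L : ℕ}
  (P : Fin L → Measure E) [∀ ℓ, IsProbabilityMeasure (P ℓ)]
  (Pout : Measure E) [IsProbabilityMeasure Pout] (w q : Fin L → ℝ≥0) (ρ : ℝ≥0)

instance : IsFiniteMeasure (trainLaw P w) := by unfold trainLaw; infer_instance

instance : IsFiniteMeasure (testLaw P Pout q ρ) := by unfold testLaw; infer_instance

theorem map_fst_restrict_trainLaw (ℓ : Fin L) :
    ((trainLaw P w).restrict (Prod.snd ⁻¹' {ℓ})).map Prod.fst = w ℓ • P ℓ := by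
  classical
  ext s hs
  rw [Measure.map_apply measurable_fst hs, Measure.restrict_apply (measurable_fst hs),
    ← Set.prod_eq, trainLaw, Measure.finsetSum_apply]
  simp only [Measure.smul_apply, Measure.prod_prod,
    Measure.dirac_apply' _ (measurableSet_singleton ℓ)]
  rw [Finset.sum_eq_single ℓ]
  · simp
  · intro j _ hj
    simp [hj]
  · simp

theorem map_fst_restrict_testLaw_normal :
    ((testLaw P Pout q ρ).restrict (Prod.snd ⁻¹' {0}ᶜ)).map Prod.fst = ∑ ℓ, q ℓ • P ℓ := by
  ext s hs
  rw [Measure.map_apply measurable_fst hs, Measure.restrict_apply (measurable_fst hs),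
    ← Set.prod_eq, testLaw, Measure.add_apply, Measure.finsetSum_apply, Measure.finsetSum_apply]
  simp [Measure.smul_apply, Measure.prod_prod, Fin.succ_ne_zero]

theorem map_fst_restrict_testLaw_anomaly :
    ((testLaw P Pout q ρ).restrict (Prod.snd ⁻¹' {0})).map Prod.fst = ρ • Pout := by
  ext s hs
  rw [Measure.map_apply measurable_fst hs, Measure.restrict_apply (measurable_fst hs),
    ← Set.prod_eq, testLaw, Measure.add_apply, Measure.finsetSum_apply]
  simp [Measure.smul_apply, Measure.prod_prod, Fin.succ_ne_zero]

theorem pi_smul_measure {n : ℕ} (a : Fin n → ℝ≥0) (Q : Fin n → Measure E)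
    [∀ i, IsProbabilityMeasure (Q i)] :
    Measure.pi (fun i => a i • Q i) = (∏ i, a i) • Measure.pi Q := by
  refine Measure.pi_eq fun s hs => ?_
  simp only [Measure.smul_apply, Measure.pi_pi, ENNReal.smul_def, smul_eq_mul,
    Finset.prod_mul_distrib, ENNReal.ofNNReal_finsetProd]

/-- The observed positions: forget all the labels. -/
def positions {n : ℕ} (ω : (Fin n → E × Fin L) × (E × Fin (L + 1))) : (Fin n → E) × E :=
  (fun i => (ω.1 i).1, ω.2.1)

theorem measurable_positions {n : ℕ} : Measurable (positions (E := E) (L := L) (n := n)) := by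
  unfold positions; fun_prop

/-- On the event that the training labels are `y` and the test label lies in `T`, the training
points are independent with `X i ∼ P (y i)`, and independent of the test point. -/
theorem map_positions_restrict_jointLaw {n : ℕ} (y : Fin n → Fin L) (T : Set (Fin (L + 1)))
    {ν : Measure E} [SFinite ν]
    (hν : ((testLaw P Pout q ρ).restrict (Prod.snd ⁻¹' T)).map Prod.fst = ν) :
    ((jointLaw P Pout w q ρ n).restrict (trainLabels y ∩ {ω | ω.2.2 ∈ T})).map positions =
      (∏ i, w (y i)) • (Measure.pi fun i => P (y i)).prod ν := by
  have hset : (trainLabels y ∩ {ω | ω.2.2 ∈ T} :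
      Set ((Fin n → E × Fin L) × (E × Fin (L + 1)))) =
      (Set.univ.pi fun i => Prod.snd ⁻¹' {y i}) ×ˢ (Prod.snd ⁻¹' T) := by
    ext ω
    simp [trainLabels]
  have hpos : positions (E := E) (L := L) (n := n) =
      Prod.map (fun (z : Fin n → E × Fin L) i => (z i).1) Prod.fst := rfl
  rw [hset, jointLaw, ← Measure.prod_restrict, hpos, ← Measure.map_prod_map _ _ (by fun_prop)
    measurable_fst, hν, Measure.restrict_pi_pi, Measure.pi_map_pi fun i => by fun_prop]
  simp only [map_fst_restrict_trainLaw]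
  rw [pi_smul_measure (fun i => w (y i)) (fun i => P (y i)), Measure.prod_smul_left]

/-- Conditional probabilities given the training labels `y` and a set `T` of test labels, for an
event that, given the labels, is about the positions only. -/
theorem cond_jointLaw_real_eq {n : ℕ} (hw : ∀ ℓ, 0 < w ℓ) (y : Fin n → Fin L)
    (T : Set (Fin (L + 1))) {ν : Measure E} [SFinite ν]
    (hν : ((testLaw P Pout q ρ).restrict (Prod.snd ⁻¹' T)).map Prod.fst = ν)
    {A : Set ((Fin n → E × Fin L) × (E × Fin (L + 1)))} {A' : Set ((Fin n → E) × E)}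
    (hA' : MeasurableSet A') (hA : ∀ ω ∈ trainLabels y, ω ∈ A ↔ positions ω ∈ A') :
    (cond (jointLaw P Pout w q ρ n) (trainLabels y ∩ {ω | ω.2.2 ∈ T})).real A =
      ((Measure.pi fun i => P (y i)).prod ν).real A' / ν.real Set.univ := by
  have hmap := map_positions_restrict_jointLaw P Pout w q ρ y T hν
  have hS : MeasurableSet (trainLabels y ∩ {ω | ω.2.2 ∈ T} :
      Set ((Fin n → E × Fin L) × (E × Fin (L + 1)))) := by
    refine MeasurableSet.inter ?_ ?_
    · have : (trainLabels y : Set ((Fin n → E × Fin L) × (E × Fin (L + 1)))) =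
          ⋂ i, (fun ω => (ω.1 i).2) ⁻¹' {y i} := by
        ext ω; simp [trainLabels]
      rw [this]
      exact MeasurableSet.iInter fun i =>
        (by fun_prop : Measurable fun ω : (Fin n → E × Fin L) × (E × Fin (L + 1)) => (ω.1 i).2)
          (measurableSet_singleton _)
    · exact (measurable_snd.comp measurable_snd) (MeasurableSet.of_discrete (s := T))
  have hμ : ∀ B' : Set ((Fin n → E) × E), MeasurableSet B' →
      jointLaw P Pout w q ρ n ((trainLabels y ∩ {ω | ω.2.2 ∈ T}) ∩ positions ⁻¹' B') =
        (∏ i, w (y i) : ℝ≥0) * ((Measure.pi fun i => P (y i)).prod ν) B' := by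
    intro B' hB'
    rw [Set.inter_comm, ← Measure.restrict_apply (measurable_positions hB'),
      ← Measure.map_apply measurable_positions hB', hmap, Measure.smul_apply, ENNReal.smul_def,
      smul_eq_mul]
  have hinter : (trainLabels y ∩ {ω | ω.2.2 ∈ T}) ∩ A =
      (trainLabels y ∩ {ω | ω.2.2 ∈ T}) ∩ positions ⁻¹' A' := by
    ext ω
    simp only [Set.mem_inter_iff, Set.mem_preimage]
    exact ⟨fun h => ⟨h.1, (hA ω h.1.1).1 h.2⟩, fun h => ⟨h.1, (hA ω h.1.1).2 h.2⟩⟩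
  have huniv := hμ Set.univ MeasurableSet.univ
  rw [Set.preimage_univ, Set.inter_univ, ← Set.univ_prod_univ, Measure.prod_prod, measure_univ,
    one_mul] at huniv
  have hw0 : ((∏ i, w (y i) : ℝ≥0) : ℝ) ≠ 0 := by
    exact_mod_cast (Finset.prod_pos fun i _ => hw (y i)).ne'
  rw [measureReal_def, cond_apply hS, hinter, hμ A' hA', huniv]
  simp only [ENNReal.toReal_mul, ENNReal.toReal_inv, ENNReal.coe_toReal, measureReal_def]
  rw [mul_inv, div_eq_mul_inv]
  field_simp

/-- Bound of a product measure by its slices, which need not be small over a set `G`. -/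
theorem measureReal_prod_le {F : Type*} [MeasurableSpace F] (μ : Measure F) [IsProbabilityMeasure μ]
    (ν : Measure E) [IsFiniteMeasure ν] {A : Set (F × E)} (hA : MeasurableSet A) (G : Set E)
    {b : ℝ} (hb : 0 ≤ b) (h : ∀ᵐ x ∂ν, x ∉ G → μ.real {X | (X, x) ∈ A} ≤ b) :
    (μ.prod ν).real A ≤ ν.real G + b * ν.real Set.univ := by
  classical
  have hle : μ.prod ν A ≤ ν G + ENNReal.ofReal b * ν Set.univ := by
    rw [Measure.prod_apply_symm hA]
    calc ∫⁻ x, μ ((fun X => (X, x)) ⁻¹' A) ∂ν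
        ≤ ∫⁻ x, (G.indicator (fun _ => 1) x + ENNReal.ofReal b) ∂ν := by
          refine lintegral_mono_ae ?_
          filter_upwards [h] with x hx
          by_cases hG : x ∈ G
          · rw [Set.indicator_of_mem hG]
            exact prob_le_one.trans le_self_add
          · rw [Set.indicator_of_notMem hG, zero_add]
            exact (ENNReal.le_ofReal_iff_toReal_le (measure_ne_top _ _) hb).2 (hx hG)
      _ = ∫⁻ x, G.indicator (fun _ => 1) x ∂ν + ENNReal.ofReal b * ν Set.univ := by
          rw [lintegral_add_right _ measurable_const, lintegral_const]
      _ ≤ _ := by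
          gcongr
          exact (lintegral_indicator_const_le G 1).trans (one_mul _).le
  have := ENNReal.toReal_mono (by finiteness) hle
  rwa [ENNReal.toReal_add (by finiteness) (by finiteness), ENNReal.toReal_mul,
    ENNReal.toReal_ofReal hb] at this

theorem measureReal_prod_sum_smul {F ι : Type*} [MeasurableSpace F] [Fintype ι] (μ : Measure F)
    [IsProbabilityMeasure μ] (ν : ι → Measure E) [∀ j, IsProbabilityMeasure (ν j)] (a : ι → ℝ≥0)
    {A : Set (F × E)} (hA : MeasurableSet A) :
    (μ.prod (∑ j, a j • ν j)).real A = ∑ j, a j * (μ.prod (ν j)).real A := by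
  rw [measureReal_def, Measure.prod_apply_symm hA, lintegral_finsetSum_measure,
    ENNReal.toReal_sum]
  · refine Finset.sum_congr rfl fun j _ => ?_
    rw [lintegral_smul_measure, ← Measure.prod_apply_symm hA, ENNReal.smul_def, smul_eq_mul,
      ENNReal.toReal_mul, ENNReal.coe_toReal, measureReal_def]
  · intro j _
    rw [lintegral_smul_measure, ← Measure.prod_apply_symm hA, ENNReal.smul_def, smul_eq_mul]
    finiteness

end Disintegration

/-! ### Level and power -/

section Test

variable {E : Type*} [NormedAddCommGroup E] [MeasurableSpace E] [BorelSpace E]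
  [SecondCountableTopology E]

theorem lt_testStat_iff {L n k : ℕ} {c : Fin L → ℝ} {c₀ : ℝ} (h0 : 0 < c₀) (h1 : c₀ < 1)
    {y : Fin n → Fin L} {ω : (Fin n → E × Fin L) × (E × Fin (L + 1))} (hω : ω ∈ trainLabels y) :
    c₀ < testStat k c ω ↔
      ∀ ℓ, c ℓ < knnSqDist k (classIdx y ℓ) (positions ω).1 (positions ω).2 := by
  have hy : (fun i => (ω.1 i).2) = y := funext hω
  unfold testStat
  rw [hy]
  change _ ↔ ∀ ℓ, c ℓ < knnSqDist k (classIdx y ℓ) (fun i => (ω.1 i).1) ω.2.1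
  constructor
  · intro h ℓ
    by_contra hcon
    rw [Finset.prod_eq_zero (Finset.mem_univ ℓ) (if_neg hcon)] at h
    exact lt_asymm h h0
  · intro h
    rwa [Finset.prod_congr rfl fun ℓ _ => if_pos (h ℓ), Finset.prod_const_one]

theorem measurableSet_lt_knnSqDist {n : ℕ} (k : ℕ) (I : Finset (Fin n)) (c : ℝ) :
    MeasurableSet {z : (Fin n → E) × E | c < knnSqDist k I z.1 z.2} :=
  measurableSet_lt measurable_const (measurable_knnSqDist k I)

/-- Level of the test against one class, uniformly over the sampling scheme: a fresh point from
`P` lies far from a large sample from `P` with probability at most `α + e`. -/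
theorem exists_forall_measureReal_lt_knnSqDist_le (P : Measure E) [IsProbabilityMeasure P]
    {S : Set E} (hS : ∀ᵐ x ∂P, x ∈ S) {α C C' ε₀ e : ℝ} (hC : 0 < C) (hC' : 0 < C')
    (hε₀ : 0 < ε₀) (he : 0 < e) :
    ∃ N₀ : ℕ, ∀ (n k : ℕ) (I : Finset (Fin n)) (Q : Fin n → Measure E)
      [∀ i, IsProbabilityMeasure (Q i)] (c : ℝ), (∀ i ∈ I, Q i = P) → 1 ≤ k → k ≤ I.card →
      N₀ ≤ I.card → IsThreshold P (k / I.card) α c → HasShellMass P S (k / I.card) C ε₀ →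
      HasSmallMargin P (k / I.card) c C' ε₀ →
      ((Measure.pi Q).prod P).real {z | c < knnSqDist k I z.1 z.2} ≤ α + e := by
  obtain ⟨ε, hε, hεe, hεε₀⟩ : ∃ ε : ℝ, 0 < ε ∧ ε ≤ e / 2 ∧ ε < ε₀ :=
    ⟨min (e / 2) (ε₀ / 2), by positivity, min_le_left _ _,
      (min_le_right _ _).trans_lt (by linarith)⟩
  set κ := C' * ε / 2 with hκ
  have hκ0 : 0 < κ := by positivity
  have hlim : Tendsto (fun J : ℕ => 2 / (J : ℝ)) atTop (nhds 0) :=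
    tendsto_const_div_atTop_nhds_zero_nat 2
  obtain ⟨J, hJ, hJε, hJκ⟩ : ∃ J : ℕ, 0 < J ∧ 2 / (J : ℝ) < ε₀ ∧ 2 / (J : ℝ) < κ / C :=
    ((eventually_gt_atTop 0).and ((hlim.eventually (gt_mem_nhds hε₀)).and
      (hlim.eventually (gt_mem_nhds (by positivity : 0 < κ / C))))).exists
  have hJ0 : (0 : ℝ) < J := by exact_mod_cast hJ
  have hfail : Tendsto (fun N : ℕ => J * Real.exp (-((N : ℝ) / (4 * (J : ℝ) ^ 2)))) atTop
      (nhds (J * 0)) := by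
    refine (Real.tendsto_exp_neg_atTop_nhds_zero.comp ?_).const_mul _
    exact tendsto_natCast_atTop_atTop.atTop_div_const (by positivity)
  rw [mul_zero] at hfail
  obtain ⟨N₀, hN₀⟩ := eventually_atTop.1 (hfail.eventually (gt_mem_nhds (half_pos he)))
  refine ⟨N₀, fun n k I Q _ c hQ hk hkI hI hthr hsh hmar => ?_⟩
  have hN : (0 : ℝ) < I.card := by exact_mod_cast hk.trans hkI
  have hm : (k / I.card : ℝ) < 1 := by
    obtain ⟨x, hx⟩ := hS.exists
    refine hsh.resolution_lt_one hx hC hε₀ ?_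
    rw [div_le_one hN]; exact_mod_cast hkI
  have hD := measurable_dtmSq P (m := k / I.card) (by positivity) hm
  have hc : P.real {x | c < dtmSq P (k / I.card) x} ≤ α := by
    have h1 := probReal_compl_eq_one_sub (μ := P) (hD (measurableSet_Iic (a := c)))
    have h2 : (dtmSq P (k / I.card) ⁻¹' Set.Iic c)ᶜ = {x | c < dtmSq P (k / I.card) x} := by
      ext x; simp
    have h3 : 1 - α ≤ P.real (dtmSq P (k / I.card) ⁻¹' Set.Iic c) := hthr.2.1
    rw [h2] at h1
    linarith
  have hG : P.real {x | c - κ < dtmSq P (k / I.card) x} ≤ α + e / 2 := by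
    have := hmar ε hε hεε₀ κ (by rw [hκ]; linarith [mul_pos hC' hε])
    linarith
  refine (measureReal_prod_le (Measure.pi Q) P (measurableSet_lt_knnSqDist k I c)
    {x | c - κ < dtmSq P (k / I.card) x} (half_pos he).le ?_).trans ?_
  · filter_upwards [hS] with x hx hxG
    have hxD : dtmSq P (k / I.card) x ≤ c - κ := not_lt.1 hxG
    have hCJ : C * (2 / J) < κ := by rwa [lt_div_iff₀ hC, mul_comm] at hJκ
    refine (measureReal_mono fun X hX => ?_).trans
      ((measureReal_dtmSq_add_lt_knnSqDist_le Q hQ hk hkI hsh hx hC hJ hJε).trans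
        (hN₀ _ hI).le)
    have : c < knnSqDist k I X x := hX
    rw [Set.mem_ofPred_eq]
    linarith
  · rw [probReal_univ]
    linarith

end Test

end

end Anomaly

open Anomaly in
theorem theorem4
    {E : Type*} [NormedAddCommGroup E] [NormedSpace ℝ E] [FiniteDimensional ℝ E]
    [MeasurableSpace E] [BorelSpace E] {L : ℕ}
    -- class distributions, distribution of the anomalies, mixture weights
    (P : Fin L → Measure E) [∀ ℓ, IsProbabilityMeasure (P ℓ)]
    (Pout : Measure E) [IsProbabilityMeasure Pout]
    (w q : Fin L → ℝ≥0) (ρ : ℝ≥0)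
    (hw : ∀ ℓ, 0 < w ℓ) (hw_sum : ∑ ℓ, w ℓ = 1) (hq_sum : ∑ ℓ, q ℓ + ρ = 1)
    -- nominal level, and constants that depend on the class distributions only
    (α : ℝ) (hα : 0 < α) (hα1 : α < 1)
    (C C' ε₀ : Fin L → ℝ) (hC : ∀ ℓ, 0 < C ℓ) (hC' : ∀ ℓ, 0 < C' ℓ) (hε₀ : ∀ ℓ, 0 < ε₀ ℓ) :
    -- type I error
    (∀ (k : ℕ → ℕ) (y : ∀ n, Fin n → Fin L) (c : ℕ → Fin L → ℝ),
      (∀ ℓ, Tendsto (fun n => classSize (y n) ℓ) atTop atTop) →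
      (∀ᶠ n in atTop, 1 ≤ k n ∧ ∀ ℓ, k n ≤ classSize (y n) ℓ) →
      (∀ᶠ n in atTop, ∀ ℓ,
        IsThreshold (P ℓ) (resolution (k n) (y n) ℓ) α (c n ℓ) ∧
        HasShellMass (P ℓ) ((P ℓ).support ∪ Pout.support)
          (resolution (k n) (y n) ℓ) (C ℓ) (ε₀ ℓ) ∧
        HasSmallMargin (P ℓ) (resolution (k n) (y n) ℓ) (c n ℓ) (C' ℓ) (ε₀ ℓ)) →
      0 < ∑ ℓ, q ℓ →
      ∀ c₀ : ℝ, 0 < c₀ → c₀ < 1 → ∀ e : ℝ, 0 < e → ∀ᶠ n in atTop,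
        (cond (jointLaw P Pout w q ρ n) (trainLabels (y n) ∩ isNormal)).real
          {ω | c₀ < testStat (k n) (c n) ω} ≤ α + e) ∧
    -- power
    (∀ (n k : ℕ) (y : Fin n → Fin L) (c : Fin L → ℝ),
      1 ≤ k → (∀ ℓ, k ≤ classSize y ℓ) →
      (∀ ℓ,
        IsThreshold (P ℓ) (resolution k y ℓ) α (c ℓ) ∧
        HasShellMass (P ℓ) ((P ℓ).support ∪ Pout.support) (resolution k y ℓ) (C ℓ) (ε₀ ℓ) ∧
        HasSmallMargin (P ℓ) (resolution k y ℓ) (c ℓ) (C' ℓ) (ε₀ ℓ)) →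
      0 < ρ →
      ∀ δ : ℝ, 0 < δ → δ < 1 →
      (∀ ℓ, IsSeparated (P ℓ) Pout (resolution k y ℓ) (c ℓ) (C ℓ)
        (betaRate (Module.finrank ℝ E) (classSize y ℓ) δ)) →
      ∀ c₀ : ℝ, 0 < c₀ → c₀ < 1 →
        1 - (L : ℝ) * δ ≤
          (cond (jointLaw P Pout w q ρ n) (trainLabels y ∩ isAnomaly)).real
            {ω | c₀ < testStat k c ω}) := by
  have : ProperSpace E := FiniteDimensional.proper_real E
  have hidx : ∀ {n : ℕ} (y : Fin n → Fin L) (ℓ : Fin L), ∀ i ∈ classIdx y ℓ, P (y i) = P ℓ :=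
    fun y ℓ i hi => by rw [(Finset.mem_filter.1 hi).2]
  have hmeas : ∀ {n : ℕ} (k : ℕ) (y : Fin n → Fin L) (c : Fin L → ℝ), MeasurableSet
      {z : (Fin n → E) × E | ∀ ℓ, c ℓ < knnSqDist k (classIdx y ℓ) z.1 z.2} := by
    intro n k y c
    rw [Set.ofPred_forall]
    exact MeasurableSet.iInter fun ℓ => measurableSet_lt_knnSqDist k (classIdx y ℓ) (c ℓ)
  constructor
  · intro k y c hsize hk hass hq c₀ hc₀ hc₁ e he
    choose N₀ hN₀ using fun ℓ => exists_forall_measureReal_lt_knnSqDist_le (P ℓ) (α := α)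
      (S := (P ℓ).support ∪ Pout.support)
      (Filter.mem_of_superset Measure.support_mem_ae Set.subset_union_left)
      (hC ℓ) (hC' ℓ) (hε₀ ℓ) he
    filter_upwards [hk, hass, eventually_all.2 fun ℓ => (hsize ℓ).eventually_ge_atTop (N₀ ℓ)]
      with n ⟨hk1, hkn⟩ hass hn
    have hnormal : (isNormal : Set ((Fin n → E × Fin L) × (E × Fin (L + 1)))) =
        {ω | ω.2.2 ∈ ({0}ᶜ : Set (Fin (L + 1)))} := rfl
    rw [hnormal, cond_jointLaw_real_eq P Pout w q ρ hw (y n) _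
      (A := {ω | c₀ < testStat (k n) (c n) ω}) (map_fst_restrict_testLaw_normal P Pout q ρ)
      (hmeas (k n) (y n) (c n))
      fun ω hω => lt_testStat_iff hc₀ hc₁ hω,
      measureReal_prod_sum_smul _ _ _ (hmeas (k n) (y n) (c n))]
    have huniv : (∑ ℓ, q ℓ • P ℓ).real Set.univ = ∑ ℓ, (q ℓ : ℝ) := by
      rw [measureReal_def, Measure.finsetSum_apply]
      simp only [Measure.smul_apply, measure_univ, ENNReal.smul_def, smul_eq_mul, mul_one]
      rw [ENNReal.toReal_sum fun ℓ _ => ENNReal.coe_ne_top]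
      rfl
    have hpos : (0 : ℝ) < ∑ ℓ, (q ℓ : ℝ) := by exact_mod_cast hq
    rw [huniv, div_le_iff₀ hpos, Finset.mul_sum]
    refine Finset.sum_le_sum fun ℓ _ => ?_
    rw [mul_comm (α + e)]
    refine mul_le_mul_of_nonneg_left ?_ (q ℓ).2
    have hsub : {z : (Fin n → E) × E | ∀ ℓ, c n ℓ < knnSqDist (k n) (classIdx (y n) ℓ) z.1 z.2} ⊆
        {z | c n ℓ < knnSqDist (k n) (classIdx (y n) ℓ) z.1 z.2} := fun z hz => hz ℓ
    refine (measureReal_mono hsub).trans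
      (hN₀ ℓ n (k n) (classIdx (y n) ℓ) _ (c n ℓ) (hidx (y n) ℓ) hk1 (hkn ℓ) (hn ℓ)
        (hass ℓ).1 (hass ℓ).2.1 (hass ℓ).2.2)
  · intro n k y c hk hkn hass hρ δ hδ hδ1 hsep c₀ hc₀ hc₁
    have hanomaly : (isAnomaly : Set ((Fin n → E × Fin L) × (E × Fin (L + 1)))) =
        {ω | ω.2.2 ∈ ({0} : Set (Fin (L + 1)))} := rfl
    rw [hanomaly, cond_jointLaw_real_eq P Pout w q ρ hw y _
      (A := {ω | c₀ < testStat k c ω}) (map_fst_restrict_testLaw_anomaly P Pout q ρ) (hmeas k y c)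
      fun ω hω => lt_testStat_iff hc₀ hc₁ hω]
    have hρ' : (0 : ℝ) < ρ := by exact_mod_cast hρ
    have huniv : (ρ • Pout).real Set.univ = ρ := by
      rw [measureReal_def, Measure.smul_apply, measure_univ, ENNReal.smul_def, smul_eq_mul, mul_one,
        ENNReal.coe_toReal]
    have hclass : ∀ ℓ, ∀ᵐ x ∂Pout, (Measure.pi fun i => P (y i)).real
        {X | knnSqDist k (classIdx y ℓ) X x ≤ c ℓ} ≤ δ := by
      intro ℓ
      obtain ⟨M, τ, hM, hτ, hMτ⟩ := hsep ℓ
      filter_upwards [hMτ, Measure.support_mem_ae (μ := Pout)] with x hx hxS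
      exact measureReal_knnSqDist_le_le _ (hidx y ℓ) hk (hkn ℓ) (hass ℓ).2.1
        (Or.inr hxS) (hC ℓ) (hε₀ ℓ) (hass ℓ).1.1 hδ hδ1 hM hτ hx
    have hbad := measureReal_prod_le (Measure.pi fun i => P (y i)) (ρ • Pout)
      (hmeas k y c).compl ∅ (b := L * δ) (by positivity) (by
        refine (Measure.ae_smul_measure (eventually_all.2 hclass) ρ).mono fun x hx _ => ?_
        calc _ ≤ (Measure.pi fun i => P (y i)).real
              (⋃ ℓ, {X | knnSqDist k (classIdx y ℓ) X x ≤ c ℓ}) := by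
              refine measureReal_mono fun X hX => ?_
              obtain ⟨ℓ, hℓ⟩ := not_forall.1 hX
              exact Set.mem_iUnion.2 ⟨ℓ, not_lt.1 hℓ⟩
          _ ≤ ∑ ℓ, (Measure.pi fun i => P (y i)).real
              {X | knnSqDist k (classIdx y ℓ) X x ≤ c ℓ} := measureReal_iUnion_fintype_le _
          _ ≤ ∑ _ℓ : Fin L, δ := Finset.sum_le_sum fun ℓ _ => hx ℓ
          _ = L * δ := by simp)
    rw [measureReal_empty, zero_add, measureReal_compl (hmeas k y c), ← Set.univ_prod_univ,
      measureReal_prod_prod, probReal_univ, one_mul, huniv] at hbad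
    rw [huniv, le_div_iff₀ hρ']
    linarith
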